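/- Let $N,K_1,K_2^*\in\mathbb N$ and $n_{\mathrm{in}},n_{\mathrm{eq}}\in\mathbb Z_+$. For $i=1,\dots,N$ let $\mathcal X_i\subset\mathbb R$ be non-empty and compact and let $\mu_i$ be a Borel probability measure on $\mathcal X_i$; put $\mathcal X=\mathcal X_1\times\cdots\times\mathcal X_N$. Let $c_1\in\mathbb R^{K_1}$ and let $S_1=\{a\in\mathbb R^{K_1}: L_{\mathrm{in}}a\le q_{\mathrm{in}},\ L_{\mathrm{eq}}a=q_{\mathrm{eq}}\}$ be non-empty, where $L_{\mathrm{in}}\in\mathbb R^{n_{\mathrm{in}}\times K_1}$, $q_{\mathrm{in}}\in\mathbb R^{n_{\mathrm{in}}}$, $L_{\mathrm{eq}}\in\mathbb R^{n_{\mathrm{eq}}\times K_1}$, $q_{\mathrm{eq}}\in\mathbb R^{n_{\mathrm{eq}}}$. Let $V\in\mathbb R^{K_2^*\times K_1}$, $W\in\mathbb R^{K_2^*\times N}$, $b\in\mathbb R^{K_2^*}$, let $S_2^*\subset\mathbb R^{K_2^*}$ be a non-empty polytope, and put $$Q(a,x)=\max_{\lambda\in S_2^*}\langle Va+Wx+b,\lambda\rangle,\qquad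 \phi_{\mathrm{DRO}}=\inf_{a\in S_1}\Big\{\langle c_1,a\rangle+\sup_{\mu\in\Gamma(\mu_1,\dots,\mu_N)}\int_{\mathcal X}Q(a,x)\,\mu(\mathrm dx)\Big\},$$ where $\Gamma(\mu_1,\dots,\mu_N)$ is the set of probability measures on $\mathcal X$ with marginals $\mu_1,\dots,\mu_N$. For $i=1,\dots,N$ let $\mathcal G_i=\{g_{i,1},\dots,g_{i,m_i}\}$ be a finite collection of continuous real functions on $\mathcal X_i$. Let $[\mu_i]_{\mathcal G_i}$ be the set of probability measures $\nu$ on $\mathcal X_i$ with $\int g\,\mathrm d\nu=\int g\,\mathrm d\mu_i$ for all $g\in\mathcal G_i$, and let $\overline W_{1,\mu_i}([\mu_i]_{\mathcal G_i})=\sup_{\nu\in[\mu_i]_{\mathcal G_i}}W_1(\mu_i,\nu)$, where $W_1$ is the Wasserstein metric of order 1. Consider the problem $$(\mathsf{LSIP}^*)\qquad \sup\ \langle q_{\mathrm{in}},\xi_{\mathrm{in}}\rangle+\langle q_{\mathrm{eq}},\xi_{\mathrm{eq}}\rangle+\int_{\mathcal X\times S_2^*}\langle Wx+b,\lambda\rangle\,\mu_{\mathrm{aug}}(\mathrm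 dx,\mathrm d\lambda)$$ over all $\xi_{\mathrm{in}}\in\mathbb R^{n_{\mathrm{in}}}$ with $\xi_{\mathrm{in}}\le 0$, all $\xi_{\mathrm{eq}}\in\mathbb R^{n_{\mathrm{eq}}}$, and all probability measures $\mu_{\mathrm{aug}}$ on $\mathcal X\times S_2^*$ whose marginal on $\mathcal X_i$ lies in $[\mu_i]_{\mathcal G_i}$ for each $i$, such that $L_{\mathrm{in}}^{\top}\xi_{\mathrm{in}}+L_{\mathrm{eq}}^{\top}\xi_{\mathrm{eq}}-V^{\top}\int\lambda\,\mathrm d\mu_{\mathrm{aug}}=c_1$. For $\epsilon\ge 0$, an $\epsilon$-optimizer of $(\mathsf{LSIP}^*)$ is a feasible point whose objective is at least the optimal value minus $\epsilon$. A probability measure $\tilde\mu_{\mathrm{aug}}$ on $\mathcal X\times S_2^*$ whose marginal on $\mathcal X_i$ is $\mu_i$ for each $i$ is called a partial reassembly of a probability measure $\hat\mu_{\mathrm{aug}}$ on $\mathcal X\times S_2^*$ (with marginals $\hat\mu_i$ on $\mathcal X_i$) if there is a probability measure $\gamma$ on $\mathcal X\times\mathcal X\times S_2^*\ni(x,\bar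 x,\lambda)$ such that the law of $(x,\lambda)$ under $\gamma$ is $\hat\mu_{\mathrm{aug}}$, the law of $(\bar x,\lambda)$ is $\tilde\mu_{\mathrm{aug}}$, and, for each $i$, the law of $(x_i,\bar x_i)$ is a coupling of $\hat\mu_i$ and $\mu_i$ with $\int|x_i-\bar x_i|\,\mathrm d\gamma=W_1(\hat\mu_i,\mu_i)$. Let $\epsilon\ge0$ and $\tilde\epsilon=\epsilon+\big(\sum_{i=1}^N\overline W_{1,\mu_i}([\mu_i]_{\mathcal G_i})\big)\sup_{\lambda\in S_2^*}\|W^{\top}\lambda\|_\infty$. Then, for every $\epsilon$-optimizer $(\hat\xi_{\mathrm{in}},\hat\xi_{\mathrm{eq}},\hat\mu_{\mathrm{aug}})$ of $(\mathsf{LSIP}^*)$ and every partial reassembly $\tilde\mu_{\mathrm{aug}}$ of $\hat\mu_{\mathrm{aug}}$, $$\phi_{\mathrm{DRO}}-\tilde\epsilon\ \le\ \langle q_{\mathrm{in}},\hat\xi_{\mathrm{in}}\rangle+\langle q_{\mathrm{eq}},\hat\xi_{\mathrm{eq}}\rangle+\int_{\mathcal X\times S_2^*}\langle Wx+b,\lambda\rangle\,\tilde\mu_{\mathrm{aug}}(\mathrm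 dx,\mathrm d\lambda)\ \le\ \phi_{\mathrm{DRO}}.$$ -/

import Mathlib

open MeasureTheory Matrix
open scoped ENNReal

noncomputable section

/-- A polyhedron in `ℝ^k`: an intersection of finitely many closed half-spaces. -/
def IsPolyhedron {k : ℕ} (S : Set (Fin k → ℝ)) : Prop :=
  ∃ (n : ℕ) (A : Matrix (Fin n) (Fin k) ℝ) (c : Fin n → ℝ), S = {z | A *ᵥ z ≤ c}

/-- A polytope is a bounded polyhedron. -/
def IsPolytope {k : ℕ} (S : Set (Fin k → ℝ)) : Prop :=
  IsPolyhedron S ∧ Bornology.IsBounded S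

/-- The set `Γ(μ, ν)` of couplings of two probability measures on a subset `Y` of `ℝ`. -/
def couplings₂ {Y : Set ℝ} (μ ν : ProbabilityMeasure Y) : Set (ProbabilityMeasure (Y × Y)) :=
  {γ | (γ : Measure (Y × Y)).map Prod.fst = (μ : Measure Y) ∧
       (γ : Measure (Y × Y)).map Prod.snd = (ν : Measure Y)}

/-- The transport cost `∫ |x - y| dγ`, as an extended nonnegative number. -/
def transportCost {Y : Set ℝ} (γ : Measure (Y × Y)) : ℝ≥0∞ :=
  ∫⁻ p, ENNReal.ofReal |(p.1 : ℝ) - (p.2 : ℝ)| ∂γ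

/-- The Wasserstein metric of order one between probability measures on a subset of `ℝ`. -/
def W1 {Y : Set ℝ} (μ ν : ProbabilityMeasure Y) : ℝ≥0∞ :=
  ⨅ γ ∈ couplings₂ μ ν, transportCost (γ : Measure (Y × Y))

/-- The moment set `[μ]_G`: the probability measures for which all functions in `G` are integrable
and have the same integrals as under `μ`. -/
def momentSet {Y : Set ℝ} (μ : ProbabilityMeasure Y) (G : Set (Y → ℝ)) :
    Set (ProbabilityMeasure Y) :=
  {ν | (∀ f ∈ G, Integrable f (ν : Measure Y)) ∧
       ∀ f ∈ G, ∫ x, f x ∂(ν : Measure Y) = ∫ x, f x ∂(μ : Measure Y)}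

/-- The supremum of the `W1`-distances between `μ` and the members of `[μ]_G`. -/
def W1bar {Y : Set ℝ} (μ : ProbabilityMeasure Y) (G : Set (Y → ℝ)) : ℝ≥0∞ :=
  ⨆ ν ∈ momentSet μ G, W1 μ ν

/-- The data of a two-stage distributionally robust optimization problem with marginal
constraints. The standing assumptions on the data are collected in `DROData.Standing`. -/
structure DROData (N K₁ K₂ nin neq : ℕ) where
  /-- The supports of the marginals. -/
  X : Fin N → Set ℝ
  /-- The marginals. -/
  μ : ∀ i, ProbabilityMeasure (X i)
  /-- The first-stage cost vector. -/
  c₁ : Fin K₁ → ℝ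
  /-- First-stage inequality constraints. -/
  Lin : Matrix (Fin nin) (Fin K₁) ℝ
  /-- Right-hand side of the first-stage inequality constraints. -/
  qin : Fin nin → ℝ
  /-- First-stage equality constraints. -/
  Leq : Matrix (Fin neq) (Fin K₁) ℝ
  /-- Right-hand side of the first-stage equality constraints. -/
  qeq : Fin neq → ℝ
  /-- Dependence of the second-stage problem on the first-stage decision. -/
  V : Matrix (Fin K₂) (Fin K₁) ℝ
  /-- Dependence of the second-stage problem on the uncertain quantities. -/
  W : Matrix (Fin K₂) (Fin N) ℝ
  /-- Constant term of the second-stage problem. -/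
  b : Fin K₂ → ℝ
  /-- The feasible set of the dual second-stage problem. -/
  S₂ : Set (Fin K₂ → ℝ)

namespace DROData

variable {N K₁ K₂ nin neq : ℕ}

/-- The first-stage feasible set. -/
def S₁ (D : DROData N K₁ K₂ nin neq) : Set (Fin K₁ → ℝ) :=
  {a | D.Lin *ᵥ a ≤ D.qin ∧ D.Leq *ᵥ a = D.qeq}

/-- The standing assumptions: the supports are nonempty and compact, the first-stage feasible set
is nonempty, and the dual second-stage feasible set is a nonempty polytope. -/
structure Standing (D : DROData N K₁ K₂ nin neq) : Prop where
  X_nonempty : ∀ i, (D.X i).Nonempty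
  X_compact : ∀ i, IsCompact (D.X i)
  S₁_nonempty : D.S₁.Nonempty
  S₂_nonempty : D.S₂.Nonempty
  S₂_polytope : IsPolytope D.S₂

/-- The product `X_1 × ⋯ × X_N`. -/
abbrev XX (D : DROData N K₁ K₂ nin neq) : Type := ∀ i, D.X i

/-- The vector in `ℝ^N` underlying a point of the product `X_1 × ⋯ × X_N`. -/
def vec (D : DROData N K₁ K₂ nin neq) (x : D.XX) : Fin N → ℝ := fun i => (x i : ℝ)

/-- The second-stage cost `Q(a, x) = max_{l ∈ S₂} ⟨V a + W x + b, l⟩`; the maximum is attained,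
because `S₂` is nonempty and compact under the standing assumptions. -/
def Q (D : DROData N K₁ K₂ nin neq) (a : Fin K₁ → ℝ) (x : D.XX) : ℝ :=
  ⨆ l : D.S₂, (D.V *ᵥ a + D.W *ᵥ D.vec x + D.b) ⬝ᵥ (l : Fin K₂ → ℝ)

/-- The set `Γ(ν_1, …, ν_N)` of couplings of `N` probability measures. -/
def Γ (D : DROData N K₁ K₂ nin neq) (ν : ∀ i, ProbabilityMeasure (D.X i)) :
    Set (ProbabilityMeasure D.XX) :=
  {γ | ∀ i, (γ : Measure D.XX).map (fun x => x i) = (ν i : Measure (D.X i))}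

/-- The worst-case expected cost of the first-stage decision `a`. -/
def phi (D : DROData N K₁ K₂ nin neq) (a : Fin K₁ → ℝ) : EReal :=
  ((D.c₁ ⬝ᵥ a : ℝ) : EReal) +
    ⨆ γ ∈ D.Γ D.μ, ((∫ x, D.Q a x ∂(γ : Measure D.XX) : ℝ) : EReal)

/-- The optimal value of the two-stage problem. -/
def phiDRO (D : DROData N K₁ K₂ nin neq) : EReal :=
  ⨅ a ∈ D.S₁, D.phi a

/-- The `i`-th marginal, on `X_i`, of a probability measure on `(X_1 × ⋯ × X_N) × S₂`. -/
def marginal (D : DROData N K₁ K₂ nin neq) (η : ProbabilityMeasure (D.XX × D.S₂)) (i : Fin N) :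
    ProbabilityMeasure (D.X i) :=
  η.map (f := fun p => p.1 i) ((measurable_pi_apply i).comp measurable_fst).aemeasurable

/-- The set of augmented measures with marginals `ν_1, …, ν_N` on `X_1, …, X_N`
and an arbitrary marginal on `S₂`. -/
def Γaug (D : DROData N K₁ K₂ nin neq) (ν : ∀ i, ProbabilityMeasure (D.X i)) :
    Set (ProbabilityMeasure (D.XX × D.S₂)) :=
  {η | ∀ i, D.marginal η i = ν i}

/-- The set of augmented measures whose marginals lie in the moment sets centered at `μ_i`. -/
def ΓaugMoment (D : DROData N K₁ K₂ nin neq) (G : ∀ i, Set (D.X i → ℝ)) :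
    Set (ProbabilityMeasure (D.XX × D.S₂)) :=
  {η | ∃ ν : ∀ i, ProbabilityMeasure (D.X i), (∀ i, ν i ∈ momentSet (D.μ i) (G i)) ∧ η ∈ D.Γaug ν}

/-- The integral `∫ ⟨W x + b, l⟩ dη`. -/
def costIntegral (D : DROData N K₁ K₂ nin neq) (η : ProbabilityMeasure (D.XX × D.S₂)) : ℝ :=
  ∫ p, (D.W *ᵥ D.vec p.1 + D.b) ⬝ᵥ (p.2 : Fin K₂ → ℝ) ∂(η : Measure (D.XX × D.S₂))

/-- The component-wise integral `∫ l dη`. -/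
def meanDual (D : DROData N K₁ K₂ nin neq) (η : ProbabilityMeasure (D.XX × D.S₂)) : Fin K₂ → ℝ :=
  fun k => ∫ p, (p.2 : Fin K₂ → ℝ) k ∂(η : Measure (D.XX × D.S₂))

/-- The objective `⟨qin, ξin⟩ + ⟨qeq, ξeq⟩ + ∫ ⟨W x + b, l⟩ dη` of the dual problem. -/
def dualObjective (D : DROData N K₁ K₂ nin neq) (ξin : Fin nin → ℝ) (ξeq : Fin neq → ℝ)
    (η : ProbabilityMeasure (D.XX × D.S₂)) : ℝ :=
  D.qin ⬝ᵥ ξin + D.qeq ⬝ᵥ ξeq + D.costIntegral η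

/-- Feasibility for the dual problem. -/
def DualFeasible (D : DROData N K₁ K₂ nin neq) (G : ∀ i, Set (D.X i → ℝ))
    (ξin : Fin nin → ℝ) (ξeq : Fin neq → ℝ) (η : ProbabilityMeasure (D.XX × D.S₂)) : Prop :=
  ξin ≤ 0 ∧ η ∈ D.ΓaugMoment G ∧
    D.Linᵀ *ᵥ ξin + D.Leqᵀ *ᵥ ξeq - D.Vᵀ *ᵥ D.meanDual η = D.c₁

/-- The optimal value of the dual problem. -/
def dualValue (D : DROData N K₁ K₂ nin neq) (G : ∀ i, Set (D.X i → ℝ)) : EReal :=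
  ⨆ (ξin : Fin nin → ℝ) (ξeq : Fin neq → ℝ) (η : ProbabilityMeasure (D.XX × D.S₂))
    (_ : D.DualFeasible G ξin ξeq η), ((D.dualObjective ξin ξeq η : ℝ) : EReal)

/-- An `ε`-optimizer of the dual problem: a feasible point whose objective is within `ε` of the
optimal value. -/
def IsEpsOptimizer (D : DROData N K₁ K₂ nin neq) (G : ∀ i, Set (D.X i → ℝ)) (ε : ℝ)
    (ξin : Fin nin → ℝ) (ξeq : Fin neq → ℝ) (η : ProbabilityMeasure (D.XX × D.S₂)) : Prop :=
  D.DualFeasible G ξin ξeq η ∧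
    D.dualValue G - (ε : EReal) ≤ ((D.dualObjective ξin ξeq η : ℝ) : EReal)

/-- The set of partial reassemblies of `η` with marginals `μ_1, …, μ_N`. A point of the space
`XX × XX × S₂` is a triple `(x, x', l)`, where `x'` lies in the second copy of the product. -/
def partialReassemblies (D : DROData N K₁ K₂ nin neq) (η : ProbabilityMeasure (D.XX × D.S₂)) :
    Set (ProbabilityMeasure (D.XX × D.S₂)) :=
  {η' | η' ∈ D.Γaug D.μ ∧ ∃ γ : ProbabilityMeasure (D.XX × D.XX × D.S₂),
    (γ : Measure (D.XX × D.XX × D.S₂)).map (fun t => (t.1, t.2.2)) =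
        (η : Measure (D.XX × D.S₂)) ∧
    (∀ i, ∃ γi ∈ couplings₂ (D.marginal η i) (D.μ i),
        (γ : Measure (D.XX × D.XX × D.S₂)).map (fun t => (t.1 i, t.2.1 i)) =
            (γi : Measure (D.X i × D.X i)) ∧
        transportCost (γi : Measure (D.X i × D.X i)) = W1 (D.marginal η i) (D.μ i)) ∧
    (γ : Measure (D.XX × D.XX × D.S₂)).map (fun t => (t.2.1, t.2.2)) =
        (η' : Measure (D.XX × D.S₂))}

/-- The error `ε + (∑ i, W1bar (μ_i) (G_i)) * sup_{l ∈ S₂} ‖Wᵀ l‖_∞`. The norm of `Fin N → ℝ` is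
the supremum norm; the second summand is finite under the standing assumptions. -/
def errorBound (D : DROData N K₁ K₂ nin neq) (G : ∀ i, Set (D.X i → ℝ)) (ε : ℝ) : EReal :=
  (ε : EReal) + (((∑ i, W1bar (D.μ i) (G i)) * ⨆ l ∈ D.S₂, ‖D.Wᵀ *ᵥ l‖ₑ : ℝ≥0∞) : EReal)

end DROData

end

/-! The upper bound is weak duality: a partial reassembly has the exact marginals `D.μ` and the same
law of `l`, hence the same `meanDual`, so it satisfies the dual constraint without the moment
relaxation. Its `X`-marginal is a coupling of the `D.μ i`, and the pairing lies below `Q` pointwise.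

The lower bound combines three losses. Strong duality gives `phiDRO ≤ dualValue`, since exact
marginals are admissible in the moment relaxation. The `ε`-optimizer loses at most `ε`. Reassembly
shares `l` between the two measures, so the cost changes by the integral of `⟨x - x', Wᵀ l⟩`, which
Hölder's inequality and the optimal transports bound by the `W1` distances.

Strong duality is finite-dimensional: an augmented measure enters only through the moments `(∫ l, ∫
⟨W x + b, l⟩)`, which range over a compact convex set. Separating an affine image of it from a
finitely generated, hence closed, cone yields the first-stage decision. A measurable near-maximizer
of the pairing then passes from augmented measures back to `Q`. -/

/-! ### Finitely generated cones -/

/-- Carathéodory's theorem for cones: every nonnegative combination of a finite family is a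
nonnegative combination of a linearly independent subfamily. -/
theorem exists_linearIndepOn_nonneg_combination {ι E : Type*} [Fintype ι] [AddCommGroup E]
    [Module ℝ E] (v : ι → E) (w : ι → ℝ) (hw : ∀ i, 0 ≤ w i) :
    ∃ (s : Finset ι) (w' : ι → ℝ), LinearIndepOn ℝ v (s : Set ι) ∧ (∀ i, 0 ≤ w' i) ∧
      ∑ i ∈ s, w' i • v i = ∑ i, w i • v i := by
  classical
  -- A representation of minimal support size is chosen; a linear dependence would shrink it.
  let P : ℕ → Prop := fun n => ∃ (s : Finset ι) (w' : ι → ℝ), s.card = n ∧ (∀ i, 0 ≤ w' i) ∧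
      ∑ i ∈ s, w' i • v i = ∑ i, w i • v i
  have hP : ∃ n, P n := ⟨_, Finset.univ, w, rfl, hw, rfl⟩
  obtain ⟨s, w', hs, hw', hsum⟩ := Nat.find_spec hP
  refine ⟨s, w', ?_, hw', hsum⟩
  by_contra hdep
  have hdep' : ∃ c : ι → ℝ, ∑ i ∈ s, c i • v i = 0 ∧ ∃ i ∈ s, 0 < c i := by
    rw [linearIndepOn_finset_iff] at hdep
    push Not at hdep
    obtain ⟨c, hc, i, hi, hci⟩ := hdep
    rcases lt_or_gt_of_ne hci with h | h
    · exact ⟨-c, by simp [hc], i, hi, by simpa using h⟩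
    · exact ⟨c, hc, i, hi, h⟩
  obtain ⟨c, hc, i₀, hi₀, hci₀⟩ := hdep'
  -- Ratio test: subtracting `t • c` with the least ratio `t` keeps all weights nonnegative and
  -- annihilates the weight at `j`.
  obtain ⟨j, hj, hmin⟩ := (s.filter (fun i => 0 < c i)).exists_min_image (fun i => w' i / c i)
    ⟨i₀, by simp [hi₀, hci₀]⟩
  simp only [Finset.mem_filter] at hj hmin
  set t := w' j / c j with ht
  have ht0 : 0 ≤ t := div_nonneg (hw' j) hj.2.le
  have hnonneg : ∀ i ∈ s, 0 ≤ w' i - t * c i := by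
    intro i hi
    rcases le_or_gt (c i) 0 with h | h
    · have := mul_nonpos_of_nonneg_of_nonpos ht0 h
      nlinarith [hw' i]
    · have := hmin i ⟨hi, h⟩
      rw [le_div_iff₀ h] at this
      linarith
  have hlt : (s.erase j).card < Nat.find hP := by
    rw [← hs]
    exact Finset.card_erase_lt_of_mem hj.1
  refine Nat.find_min hP hlt ⟨s.erase j, fun i => if i ∈ s then w' i - t * c i else 0, rfl, ?_, ?_⟩
  · intro i
    dsimp only
    split_ifs with h
    exacts [hnonneg i h, le_rfl]
  · rw [← hsum]
    have hj0 : w' j - t * c j = 0 := by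
      rw [ht, div_mul_cancel₀ _ hj.2.ne', sub_self]
    calc ∑ i ∈ s.erase j, (if i ∈ s then w' i - t * c i else 0) • v i
        = ∑ i ∈ s, (w' i - t * c i) • v i := by
          rw [← Finset.add_sum_erase _ _ hj.1, hj0, zero_smul, zero_add]
          refine Finset.sum_congr rfl fun i hi => ?_
          rw [if_pos (Finset.mem_of_mem_erase hi)]
      _ = ∑ i ∈ s, w' i • v i := by
          simp only [sub_smul, Finset.sum_sub_distrib, mul_smul, ← Finset.smul_sum, hc, smul_zero,
            sub_zero]

/-- A finitely generated cone in a finite-dimensional space is closed. -/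
theorem isClosed_nonneg_combinations {ι E : Type*} [Fintype ι] [AddCommGroup E] [Module ℝ E]
    [TopologicalSpace E] [IsTopologicalAddGroup E] [ContinuousSMul ℝ E] [T2Space E] (v : ι → E) :
    IsClosed {x : E | ∃ w : ι → ℝ, (∀ i, 0 ≤ w i) ∧ ∑ i, w i • v i = x} := by
  classical
  -- The cone is a finite union of images of orthants under injective linear maps, which are closed
  -- embeddings.
  have hset : {x : E | ∃ w : ι → ℝ, (∀ i, 0 ≤ w i) ∧ ∑ i, w i • v i = x} =
      ⋃ s ∈ {s : Finset ι | LinearIndepOn ℝ v (s : Set ι)},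
        (fun w : s → ℝ => ∑ i : s, w i • v i) '' {w | ∀ i, 0 ≤ w i} := by
    ext x
    simp only [Set.mem_ofPred_eq, Set.mem_iUnion, Set.mem_image, exists_prop]
    constructor
    · rintro ⟨w, hw, rfl⟩
      obtain ⟨s, w', hs, hw', hsum⟩ := exists_linearIndepOn_nonneg_combination v w hw
      refine ⟨s, hs, fun i => w' i, fun i => hw' i, ?_⟩
      rw [← hsum, ← Finset.sum_coe_sort s (fun i => w' i • v i)]
    · rintro ⟨s, hs, w, hw, rfl⟩
      refine ⟨fun i => if h : i ∈ s then w ⟨i, h⟩ else 0, fun i => ?_, ?_⟩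
      · dsimp only
        split_ifs with h
        exacts [hw _, le_rfl]
      · rw [← Finset.sum_subset (Finset.subset_univ s), ← Finset.sum_coe_sort s]
        · exact Finset.sum_congr rfl fun i _ => by simp
        · intro i _ hi
          simp [hi]
  rw [hset]
  refine Set.Finite.isClosed_biUnion (Set.toFinite _) fun s hs => ?_
  have hinj : LinearMap.ker (Fintype.linearCombination ℝ (fun i : s => v i)) = ⊥ := by
    rw [LinearMap.ker_eq_bot]
    exact LinearIndependent.fintypeLinearCombination_injective hs
  have hemb := LinearMap.isClosedEmbedding_of_injective hinj
  have hfun : (fun w : s → ℝ => ∑ i : s, w i • v i) =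
      Fintype.linearCombination ℝ (fun i : s => v i) := by
    ext w
    rw [Fintype.linearCombination_apply]
  rw [hfun]
  refine hemb.isClosedMap _ ?_
  simp only [Set.ofPred_forall]
  exact isClosed_iInter fun i => isClosed_le continuous_const (continuous_apply i)

/-! ### Finite-dimensional minimax duality -/

/-- A continuous linear functional on `ℝ^k × ℝ` is given by a vector and a scalar. -/
theorem exists_dotProduct_add_mul {k : ℕ} (f : StrongDual ℝ ((Fin k → ℝ) × ℝ)) :
    ∃ (a : Fin k → ℝ) (τ : ℝ), ∀ y z, f (y, z) = a ⬝ᵥ y + τ * z := by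
  refine ⟨fun i => f (Pi.single i 1, 0), f (0, 1), fun y z => ?_⟩
  have h : (y, z) = ∑ i, y i • ((Pi.single i 1, 0) : (Fin k → ℝ) × ℝ) + z • (0, 1) := by
    ext i
    · simp [Prod.fst_sum, Finset.sum_apply, Pi.single_apply]
    · simp [Prod.snd_sum]
  rw [h]
  simp only [map_add, map_sum, map_smul, smul_eq_mul, dotProduct, mul_comm]

/-- Strong duality between a linearly constrained minimax problem and its dual problem: if `r`
exceeds all dual objective values, then some primal feasible point has worst-case value at most
`r`. -/
theorem exists_primal_le_of_dual_lt {K₁ K₂ nin neq : ℕ} (c₁ : Fin K₁ → ℝ)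
    (Lin : Matrix (Fin nin) (Fin K₁) ℝ) (qin : Fin nin → ℝ)
    (Leq : Matrix (Fin neq) (Fin K₁) ℝ) (qeq : Fin neq → ℝ)
    (V : Matrix (Fin K₂) (Fin K₁) ℝ) {C : Set ((Fin K₂ → ℝ) × ℝ)} (hC : IsCompact C)
    (hconv : Convex ℝ C) (hS : ∃ a, Lin *ᵥ a ≤ qin ∧ Leq *ᵥ a = qeq) {r : ℝ}
    (hr : ∀ (ξin : Fin nin → ℝ) (ξeq : Fin neq → ℝ), ∀ p ∈ C, ξin ≤ 0 →
      Linᵀ *ᵥ ξin + Leqᵀ *ᵥ ξeq - Vᵀ *ᵥ p.1 = c₁ → qin ⬝ᵥ ξin + qeq ⬝ᵥ ξeq + p.2 < r) :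
    ∃ a, (Lin *ᵥ a ≤ qin ∧ Leq *ᵥ a = qeq) ∧ ∀ p ∈ C, c₁ ⬝ᵥ a + ((V *ᵥ a) ⬝ᵥ p.1 + p.2) ≤ r := by
  classical
  -- The cone `K` consists of the pairs `(Linᵀ ξin + Leqᵀ ξeq, s)` with `ξin ≤ 0` and `s ≤ ⟨qin,
  -- ξin⟩ + ⟨qeq, ξeq⟩`. Thus `T p ∈ K` would mean a dual feasible point of value at least `r`.
  let gen : Fin nin ⊕ Fin neq ⊕ Fin neq ⊕ Unit → (Fin K₁ → ℝ) × ℝ :=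
    Sum.elim (fun i => (-Lin i, -qin i)) (Sum.elim (fun j => (Leq j, qeq j))
      (Sum.elim (fun j => (-Leq j, -qeq j)) fun _ => (0, -1)))
  set K := {x | ∃ w : Fin nin ⊕ Fin neq ⊕ Fin neq ⊕ Unit → ℝ, (∀ i, 0 ≤ w i) ∧
    ∑ i, w i • gen i = x} with hK
  have hKclosed : IsClosed K := isClosed_nonneg_combinations gen
  have hKconv : Convex ℝ K := by
    rintro _ ⟨w, hw, rfl⟩ _ ⟨w', hw', rfl⟩ s t hs ht _
    refine ⟨fun i => s * w i + t * w' i, fun i => ?_, ?_⟩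
    · have := mul_nonneg hs (hw i)
      have := mul_nonneg ht (hw' i)
      positivity
    · simp only [add_smul, mul_smul, Finset.sum_add_distrib, Finset.smul_sum]
  let T : (Fin K₂ → ℝ) × ℝ → (Fin K₁ → ℝ) × ℝ := fun p => (c₁ + Vᵀ *ᵥ p.1, r - p.2)
  have hTcont : Continuous T := by
    refine Continuous.prodMk ?_ (by fun_prop)
    exact continuous_const.add (Continuous.matrix_mulVec continuous_const continuous_fst)
  have hTconv : Convex ℝ (T '' C) := by
    rintro _ ⟨p, hp, rfl⟩ _ ⟨q, hq, rfl⟩ s t hs ht hst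
    refine ⟨s • p + t • q, hconv hp hq hs ht hst, ?_⟩
    have ht' : t = 1 - s := by linarith
    subst ht'
    simp only [T, Prod.fst_add, Prod.snd_add, Prod.smul_fst, Prod.smul_snd, mulVec_add,
      mulVec_smul, Prod.smul_mk, Prod.mk_add_mk, smul_eq_mul]
    refine Prod.ext ?_ ?_
    · simp only
      module
    · simp only
      ring
  have hdisj : Disjoint (T '' C) K := by
    rw [Set.disjoint_left]
    rintro _ ⟨p, hp, rfl⟩ ⟨w, hw, hwT⟩
    simp only [Fintype.sum_sum_type, gen, Sum.elim_inl, Sum.elim_inr, Finset.univ_unique,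
      Finset.sum_singleton, T, Prod.ext_iff, Prod.fst_add, Prod.snd_add, Prod.fst_sum,
      Prod.snd_sum, Prod.smul_fst, Prod.smul_snd, smul_eq_mul] at hwT
    obtain ⟨h1, h2⟩ := hwT
    have := hr (fun i => - w (.inl i)) (fun j => w (.inr (.inl j)) - w (.inr (.inr (.inl j)))) p hp
      (fun i => by simpa using hw (.inl i)) ?_
    · have h3 := hw (.inr (.inr (.inr default)))
      simp only [dotProduct, mul_neg, mul_sub, Finset.sum_neg_distrib,
        Finset.sum_sub_distrib, mul_one] at this h2
      simp only [mul_comm (qin _), mul_comm (qeq _)] at this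
      linarith
    · rw [sub_eq_iff_eq_add, ← h1]
      ext k
      simp [mulVec, dotProduct, mul_comm, sub_eq_add_neg, mul_add, Finset.sum_add_distrib]
  obtain ⟨f, u, v, hfT, huv, hfK⟩ :=
    geometric_hahn_banach_compact_closed hTconv (hC.image hTcont) hKconv hKclosed hdisj
  obtain ⟨a, τ, hf⟩ := exists_dotProduct_add_mul f
  have hv : v < 0 := by simpa using hfK 0 ⟨0, fun _ => le_rfl, by simp⟩
  have hgen : ∀ i, 0 ≤ f (gen i) := by
    intro i
    by_contra! hneg
    -- A negative value on a generator could be scaled to equal `v`, contradicting `v < f` on `K`.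
    have hmem : (v / f (gen i)) • gen i ∈ K := by
      refine ⟨Pi.single i (v / f (gen i)), fun j => ?_, ?_⟩
      · rcases eq_or_ne j i with rfl | h
        · simpa using div_nonneg_of_nonpos hv.le hneg.le
        · simp [h]
      · simp [Pi.single_apply]
    have := hfK _ hmem
    rw [map_smul, smul_eq_mul, div_mul_cancel₀ _ hneg.ne] at this
    exact lt_irrefl _ this
  obtain ⟨σ, rfl⟩ : ∃ σ, τ = -σ := ⟨-τ, by simp⟩
  have hσ : 0 ≤ σ := by simpa [gen, hf] using hgen (.inr (.inr (.inr ())))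
  have hin : ∀ i, (Lin *ᵥ a) i ≤ σ * qin i := by
    intro i
    have h := hgen (.inl i)
    simp only [gen, Sum.elim_inl, hf, dotProduct_neg] at h
    rw [mulVec, dotProduct_comm]
    linarith
  have heq : ∀ j, (Leq *ᵥ a) j = σ * qeq j := by
    intro j
    have h := hgen (.inr (.inl j))
    have h' := hgen (.inr (.inr (.inl j)))
    simp only [gen, Sum.elim_inl, Sum.elim_inr, hf, dotProduct_neg] at h h'
    rw [mulVec, dotProduct_comm]
    linarith
  have hT : ∀ p ∈ C, c₁ ⬝ᵥ a + (V *ᵥ a) ⬝ᵥ p.1 - σ * (r - p.2) < u := by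
    intro p hp
    have h := hfT _ ⟨p, hp, rfl⟩
    simp only [T, hf, dotProduct_add, dotProduct_mulVec, vecMul_transpose] at h
    rw [dotProduct_comm c₁]
    linarith
  -- If `σ = 0`, then `a` is a recession direction of the feasible set along which the cost falls at
  -- rate at least `-u > 0`; a long enough step from any feasible `a₀` brings it below `r`. If `σ >
  -- 0`, dividing by `σ` gives the required point.
  rcases hσ.eq_or_lt with h0 | hpos
  · rw [← h0] at hin heq hT
    obtain ⟨a₀, hin₀, heq₀⟩ := hS
    obtain ⟨B, hB⟩ := (hC.image (f := fun p : (Fin K₂ → ℝ) × ℝ => c₁ ⬝ᵥ a₀ +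
      ((V *ᵥ a₀) ⬝ᵥ p.1 + p.2)) (by fun_prop)).bddAbove
    have hBr : 0 ≤ |B - r| / (-u) := div_nonneg (abs_nonneg _) (by linarith)
    refine ⟨a₀ + (|B - r| / (-u)) • a, ⟨fun i => ?_, ?_⟩, fun p hp => ?_⟩
    · have h1 := hin₀ i
      have h2 := mul_nonpos_of_nonneg_of_nonpos hBr (by simpa using hin i)
      simp only [mulVec_add, mulVec_smul, Pi.add_apply, Pi.smul_apply, smul_eq_mul]
      linarith
    · ext j
      simp [mulVec_add, mulVec_smul, heq₀, heq j]
    · have h1 := hB ⟨p, hp, rfl⟩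
      have h2 := mul_le_mul_of_nonneg_left (hT p hp).le hBr
      have h3 : |B - r| / (-u) * u = -|B - r| := by
        have : u ≠ 0 := by linarith
        field_simp
      simp only [mulVec_add, mulVec_smul, dotProduct_add, dotProduct_smul, add_dotProduct,
        smul_dotProduct, smul_eq_mul] at h1 h2 ⊢
      linarith [le_abs_self (B - r)]
  · refine ⟨σ⁻¹ • a, ⟨fun i => ?_, ?_⟩, fun p hp => ?_⟩
    · simp only [mulVec_smul, Pi.smul_apply, smul_eq_mul]
      rw [inv_mul_le_iff₀ hpos]
      exact hin i
    · ext j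
      simp only [mulVec_smul, Pi.smul_apply, smul_eq_mul, heq j]
      rw [inv_mul_cancel_left₀ hpos.ne']
    · have h := mul_le_mul_of_nonneg_left ((hT p hp).trans (huv.trans hv)).le (inv_pos.2 hpos).le
      rw [mul_zero, mul_sub, inv_mul_cancel_left₀ hpos.ne'] at h
      simp only [mulVec_smul, dotProduct_smul, smul_dotProduct, smul_eq_mul]
      linarith

/-! ### Measurable near-maximizers -/

/-- A continuous function of two variables on a product with a compact second factor has
measurable approximate maximizers. -/
theorem exists_measurable_approx_argmax {X Y : Type*} [TopologicalSpace X] [MeasurableSpace X]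
    [OpensMeasurableSpace X] [TopologicalSpace Y] [CompactSpace Y]
    [TopologicalSpace.SeparableSpace Y] [Nonempty Y] [MeasurableSpace Y] {f : X → Y → ℝ}
    (hf : Continuous fun p : X × Y => f p.1 p.2) {δ : ℝ} (hδ : 0 < δ) :
    ∃ s : X → Y, Measurable s ∧ ∀ x y, f x y ≤ f x (s x) + δ := by
  classical
  let d := TopologicalSpace.denseSeq Y
  have hex : ∀ x, ∃ n, ∀ y, f x y ≤ f x (d n) + δ := by
    intro x
    have hfx : Continuous (f x) := hf.comp (Continuous.prodMk_right x)
    obtain ⟨y₀, -, hy₀⟩ := isCompact_univ.exists_isMaxOn Set.univ_nonempty hfx.continuousOn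
    obtain ⟨y, hy, n, rfl⟩ := (TopologicalSpace.denseRange_denseSeq Y).inter_open_nonempty
      {y | f x y₀ - δ < f x y} (isOpen_lt continuous_const hfx) ⟨y₀, by simpa using hδ⟩
    refine ⟨n, fun y => ?_⟩
    have h1 : f x y ≤ f x y₀ := hy₀ (Set.mem_univ y)
    have h2 : f x y₀ - δ < f x (d n) := hy
    linarith
  -- Taking the least index that works makes the selection measurable, because each index works on a
  -- closed set of `x`.
  refine ⟨fun x => d (Nat.find (hex x)), ?_, fun x => Nat.find_spec (hex x)⟩
  refine Measurable.find (f := fun n _ => d n) (p := fun n x => ∀ y, f x y ≤ f x (d n) + δ)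
    (fun n => measurable_const) (fun n => ?_) hex
  have hcl : IsClosed {x | ∀ y, f x y ≤ f x (d n) + δ} := by
    simp only [Set.ofPred_forall]
    refine isClosed_iInter fun y => isClosed_le ?_ (Continuous.add ?_ continuous_const)
    · exact hf.comp (Continuous.prodMk_left y)
    · exact hf.comp (Continuous.prodMk_left (d n))
  exact hcl.measurableSet

theorem IsPolyhedron.isClosed {k : ℕ} {S : Set (Fin k → ℝ)} (hS : IsPolyhedron S) :
    IsClosed S := by
  obtain ⟨n, A, c, rfl⟩ := hS
  exact isClosed_le (Continuous.matrix_mulVec continuous_const continuous_id) continuous_const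

theorem IsPolytope.isCompact {k : ℕ} {S : Set (Fin k → ℝ)} (hS : IsPolytope S) : IsCompact S :=
  Metric.isCompact_of_isClosed_isBounded hS.1.isClosed hS.2

theorem W1_comm {Y : Set ℝ} (μ ν : ProbabilityMeasure Y) : W1 μ ν = W1 ν μ := by
  have key : ∀ μ ν : ProbabilityMeasure Y, W1 μ ν ≤ W1 ν μ := by
    intro μ ν
    refine le_iInf₂ fun γ hγ => ?_
    have hmem : γ.map measurable_swap.aemeasurable ∈ couplings₂ μ ν := by
      constructor <;> rw [ProbabilityMeasure.toMeasure_map]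
      · rw [Measure.map_map measurable_fst measurable_swap]
        exact hγ.2
      · rw [Measure.map_map measurable_snd measurable_swap]
        exact hγ.1
    refine (iInf₂_le _ hmem).trans_eq ?_
    rw [ProbabilityMeasure.toMeasure_map]
    unfold transportCost
    rw [lintegral_map (by fun_prop) measurable_swap]
    simp only [Prod.fst_swap, Prod.snd_swap, abs_sub_comm]
  exact le_antisymm (key μ ν) (key ν μ)

/-! ### Continuity and integrability of the costs -/

namespace DROData

variable {N K₁ K₂ nin neq : ℕ} (D : DROData N K₁ K₂ nin neq)

theorem Standing.compactSpace_XX {D : DROData N K₁ K₂ nin neq} (hD : D.Standing) :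
    CompactSpace D.XX := by
  have : ∀ i, CompactSpace (D.X i) := fun i => isCompact_iff_compactSpace.1 (hD.X_compact i)
  infer_instance

theorem Standing.compactSpace_S₂ {D : DROData N K₁ K₂ nin neq} (hD : D.Standing) :
    CompactSpace D.S₂ :=
  isCompact_iff_compactSpace.1 hD.S₂_polytope.isCompact

theorem continuous_vec : Continuous D.vec :=
  continuous_pi fun i => continuous_subtype_val.comp (continuous_apply i)

theorem continuous_pairing (w : Fin K₂ → ℝ) :
    Continuous fun p : D.XX × D.S₂ => (w + D.W *ᵥ D.vec p.1 + D.b) ⬝ᵥ (p.2 : Fin K₂ → ℝ) := by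
  refine Continuous.dotProduct ?_ (by fun_prop)
  exact (continuous_const.add (Continuous.matrix_mulVec continuous_const
    (D.continuous_vec.comp continuous_fst))).add continuous_const

theorem continuous_cost :
    Continuous fun p : D.XX × D.S₂ => (D.W *ᵥ D.vec p.1 + D.b) ⬝ᵥ (p.2 : Fin K₂ → ℝ) := by
  simpa using D.continuous_pairing 0

theorem continuous_dual_coord (k : Fin K₂) :
    Continuous fun p : D.XX × D.S₂ => (p.2 : Fin K₂ → ℝ) k := by
  exact (continuous_apply k).comp (continuous_subtype_val.comp continuous_snd)

variable {D}

theorem Standing.integrable (hD : D.Standing) {f : D.XX × D.S₂ → ℝ} (hf : Continuous f)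
    (η : Measure (D.XX × D.S₂)) [IsFiniteMeasure η] : Integrable f η := by
  have := hD.compactSpace_XX
  have := hD.compactSpace_S₂
  exact hf.integrable_of_hasCompactSupport (HasCompactSupport.of_compactSpace f)

/-- Reduces both duality inequalities to the two moments of `η`. -/
theorem Standing.integral_pairing (hD : D.Standing) (w : Fin K₂ → ℝ)
    (η : ProbabilityMeasure (D.XX × D.S₂)) :
    ∫ p, (w + D.W *ᵥ D.vec p.1 + D.b) ⬝ᵥ (p.2 : Fin K₂ → ℝ) ∂(η : Measure (D.XX × D.S₂)) =
      w ⬝ᵥ D.meanDual η + D.costIntegral η := by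
  have hk : ∀ k ∈ Finset.univ, Integrable (fun p : D.XX × D.S₂ => w k * (p.2 : Fin K₂ → ℝ) k)
      (η : Measure (D.XX × D.S₂)) := fun k _ =>
    (hD.integrable (D.continuous_dual_coord k) η).const_mul _
  have h1 : ∫ p, w ⬝ᵥ (p.2 : Fin K₂ → ℝ) ∂(η : Measure (D.XX × D.S₂)) = w ⬝ᵥ D.meanDual η := by
    simp only [dotProduct, meanDual]
    rw [integral_finsetSum _ hk]
    simp only [integral_const_mul]
  rw [costIntegral, ← h1, ← integral_add]
  · simp only [add_assoc, add_dotProduct]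
  · exact integrable_finsetSum _ hk
  · exact hD.integrable D.continuous_cost η

theorem Standing.continuous_Q (hD : D.Standing) (a : Fin K₁ → ℝ) : Continuous (D.Q a) := by
  have := hD.compactSpace_S₂
  have h := (isCompact_univ (X := D.S₂)).continuous_sSup (f := fun (x : D.XX) (l : D.S₂) =>
    (D.V *ᵥ a + D.W *ᵥ D.vec x + D.b) ⬝ᵥ (l : Fin K₂ → ℝ)) (D.continuous_pairing (D.V *ᵥ a))
  simp only [Set.image_univ] at h
  exact h

theorem Standing.integrable_Q (hD : D.Standing) (a : Fin K₁ → ℝ) (γ : Measure D.XX)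
    [IsFiniteMeasure γ] : Integrable (D.Q a) γ := by
  have := hD.compactSpace_XX
  exact (hD.continuous_Q a).integrable_of_hasCompactSupport (HasCompactSupport.of_compactSpace _)

theorem Standing.pairing_le_Q (hD : D.Standing) (a : Fin K₁ → ℝ) (p : D.XX × D.S₂) :
    (D.V *ᵥ a + D.W *ᵥ D.vec p.1 + D.b) ⬝ᵥ (p.2 : Fin K₂ → ℝ) ≤ D.Q a p.1 := by
  have := hD.compactSpace_S₂
  refine le_ciSup (f := fun l : D.S₂ =>
    (D.V *ᵥ a + D.W *ᵥ D.vec p.1 + D.b) ⬝ᵥ (l : Fin K₂ → ℝ)) ?_ p.2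
  refine IsCompact.bddAbove (isCompact_range ?_)
  exact (D.continuous_pairing (D.V *ᵥ a)).comp (Continuous.prodMk_right p.1)

/-! ### Weak and strong duality -/

/-- Weak duality. -/
theorem Standing.dualObjective_le_phi (hD : D.Standing) {ξin : Fin nin → ℝ} {ξeq : Fin neq → ℝ}
    {η : ProbabilityMeasure (D.XX × D.S₂)} (hξ : ξin ≤ 0) (hη : η ∈ D.Γaug D.μ)
    (hc : D.Linᵀ *ᵥ ξin + D.Leqᵀ *ᵥ ξeq - D.Vᵀ *ᵥ D.meanDual η = D.c₁) {a : Fin K₁ → ℝ}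
    (ha : a ∈ D.S₁) : ((D.dualObjective ξin ξeq η : ℝ) : EReal) ≤ D.phi a := by
  let γ : ProbabilityMeasure D.XX := η.map measurable_fst.aemeasurable
  have hγ : γ ∈ D.Γ D.μ := by
    intro i
    rw [← hη i, marginal, ProbabilityMeasure.toMeasure_map, ProbabilityMeasure.toMeasure_map,
      Measure.map_map (measurable_pi_apply i) measurable_fst]
    rfl
  have h1 : (D.V *ᵥ a) ⬝ᵥ D.meanDual η + D.costIntegral η ≤
      ∫ x, D.Q a x ∂(γ : Measure D.XX) := by
    rw [← hD.integral_pairing, ProbabilityMeasure.toMeasure_map, integral_map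
      measurable_fst.aemeasurable (hD.continuous_Q a).aestronglyMeasurable]
    exact integral_mono (hD.integrable (D.continuous_pairing _) _)
      (hD.integrable ((hD.continuous_Q a).comp continuous_fst) _) (hD.pairing_le_Q a)
  have h2 : D.qin ⬝ᵥ ξin ≤ ξin ⬝ᵥ (D.Lin *ᵥ a) := by
    rw [dotProduct_comm]
    refine Finset.sum_le_sum fun i _ => ?_
    exact mul_le_mul_of_nonpos_left (ha.1 i) (hξ i)
  have h3 : D.c₁ ⬝ᵥ a = ξin ⬝ᵥ (D.Lin *ᵥ a) + D.qeq ⬝ᵥ ξeq - (D.V *ᵥ a) ⬝ᵥ D.meanDual η := by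
    rw [← hc, ← ha.2, sub_dotProduct, add_dotProduct, mulVec_transpose, mulVec_transpose,
      mulVec_transpose, ← dotProduct_mulVec, ← dotProduct_mulVec, ← dotProduct_mulVec,
      dotProduct_comm ξeq, dotProduct_comm (D.meanDual η)]
  have h4 : D.dualObjective ξin ξeq η ≤ D.c₁ ⬝ᵥ a + ∫ x, D.Q a x ∂(γ : Measure D.XX) := by
    rw [dualObjective]
    linarith
  calc ((D.dualObjective ξin ξeq η : ℝ) : EReal)
      ≤ ((D.c₁ ⬝ᵥ a : ℝ) : EReal) + ((∫ x, D.Q a x ∂(γ : Measure D.XX) : ℝ) : EReal) := by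
        exact_mod_cast h4
    _ ≤ D.phi a := by
        unfold phi
        gcongr
        exact le_iSup₂_of_le γ hγ le_rfl

/-- The pair of moments `(∫ l dη, ∫ ⟨W x + b, l⟩ dη)` depends continuously on `η`. -/
theorem Standing.continuous_moments (hD : D.Standing) :
    Continuous fun η : ProbabilityMeasure (D.XX × D.S₂) => (D.meanDual η, D.costIntegral η) := by
  have := hD.compactSpace_XX
  have := hD.compactSpace_S₂
  refine Continuous.prodMk (continuous_pi fun k => ?_) ?_
  · exact ProbabilityMeasure.continuous_integral_continuousMap
      (⟨_, D.continuous_dual_coord k⟩ : C(D.XX × D.S₂, ℝ))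
  · exact ProbabilityMeasure.continuous_integral_continuousMap
      (⟨_, D.continuous_cost⟩ : C(D.XX × D.S₂, ℝ))

/-- Probability measures on a compact space form a weakly compact set, and fixing marginals is a
weakly closed condition. -/
theorem Standing.isCompact_Γaug (hD : D.Standing) : IsCompact (D.Γaug D.μ) := by
  have := hD.compactSpace_XX
  have := hD.compactSpace_S₂
  refine IsClosed.isCompact ?_
  have : D.Γaug D.μ = ⋂ i, {η | D.marginal η i = D.μ i} := by
    ext η
    simp [Γaug]
  rw [this]
  refine isClosed_iInter fun i => isClosed_eq ?_ continuous_const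
  exact ProbabilityMeasure.continuous_map ((continuous_apply i).comp continuous_fst)

/-- Mixing two measures preserves common marginals and mixes the moments affinely. -/
theorem Standing.convex_moments (hD : D.Standing) :
    Convex ℝ ((fun η => (D.meanDual η, D.costIntegral η)) '' D.Γaug D.μ) := by
  rintro _ ⟨η₁, h₁, rfl⟩ _ ⟨η₂, h₂, rfl⟩ s t hs ht hst
  have hst' : ENNReal.ofReal s + ENNReal.ofReal t = 1 := by
    rw [← ENNReal.ofReal_add hs ht, hst, ENNReal.ofReal_one]
  let η : ProbabilityMeasure (D.XX × D.S₂) :=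
    ⟨ENNReal.ofReal s • (η₁ : Measure (D.XX × D.S₂)) +
      ENNReal.ofReal t • (η₂ : Measure (D.XX × D.S₂)), ⟨by simp [hst']⟩⟩
  have hint : ∀ f : D.XX × D.S₂ → ℝ, Continuous f → ∫ p, f p ∂(η : Measure (D.XX × D.S₂)) =
      s * ∫ p, f p ∂(η₁ : Measure (D.XX × D.S₂)) +
        t * ∫ p, f p ∂(η₂ : Measure (D.XX × D.S₂)) := by
    intro f hf
    have e : (η : Measure (D.XX × D.S₂)) = ENNReal.ofReal s • (η₁ : Measure (D.XX × D.S₂)) +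
      ENNReal.ofReal t • (η₂ : Measure (D.XX × D.S₂)) := rfl
    rw [e, integral_add_measure ((hD.integrable hf _).smul_measure ENNReal.ofReal_ne_top)
      ((hD.integrable hf _).smul_measure ENNReal.ofReal_ne_top), integral_smul_measure,
      integral_smul_measure, ENNReal.toReal_ofReal hs, ENNReal.toReal_ofReal ht, smul_eq_mul,
      smul_eq_mul]
  refine ⟨η, fun i => ?_, Prod.ext (funext fun k => ?_) ?_⟩
  · have hm : Measurable fun p : D.XX × D.S₂ => p.1 i :=
      (measurable_pi_apply i).comp measurable_fst
    have e₁ := congrArg (fun ν : ProbabilityMeasure (D.X i) => (ν : Measure (D.X i))) (h₁ i)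
    have e₂ := congrArg (fun ν : ProbabilityMeasure (D.X i) => (ν : Measure (D.X i))) (h₂ i)
    simp only [marginal, ProbabilityMeasure.toMeasure_map] at e₁ e₂
    apply ProbabilityMeasure.toMeasure_injective
    rw [marginal, ProbabilityMeasure.toMeasure_map]
    change (ENNReal.ofReal s • (η₁ : Measure (D.XX × D.S₂)) +
      ENNReal.ofReal t • (η₂ : Measure (D.XX × D.S₂))).map _ = _
    rw [Measure.map_add _ _ hm, Measure.map_smul, Measure.map_smul, e₁, e₂, ← add_smul, hst',
      one_smul]
  · exact hint _ (D.continuous_dual_coord k)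
  · exact hint _ D.continuous_cost

/-- The expected second-stage cost under a coupling is bounded by the expectation of the dual
pairing over augmented couplings. -/
theorem Standing.integral_Q_le (hD : D.Standing) {a : Fin K₁ → ℝ} {R : ℝ}
    (hR : ∀ η ∈ D.Γaug D.μ, (D.V *ᵥ a) ⬝ᵥ D.meanDual η + D.costIntegral η ≤ R)
    {γ : ProbabilityMeasure D.XX} (hγ : γ ∈ D.Γ D.μ) :
    ∫ x, D.Q a x ∂(γ : Measure D.XX) ≤ R := by
  have := hD.compactSpace_S₂
  have : Nonempty D.S₂ := hD.S₂_nonempty.to_subtype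
  refine le_of_forall_pos_le_add fun δ hδ => ?_
  obtain ⟨s, hs, hsle⟩ := exists_measurable_approx_argmax (D.continuous_pairing (D.V *ᵥ a)) hδ
    (f := fun (x : D.XX) (l : D.S₂) => (D.V *ᵥ a + D.W *ᵥ D.vec x + D.b) ⬝ᵥ (l : Fin K₂ → ℝ))
  have hgr : Measurable fun x : D.XX => (x, s x) := measurable_id.prodMk hs
  -- Lifting `γ` to the graph of `s` keeps its marginals and loses at most `δ` in the pairing.
  let η : ProbabilityMeasure (D.XX × D.S₂) := γ.map hgr.aemeasurable
  have hη : η ∈ D.Γaug D.μ := by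
    intro i
    apply ProbabilityMeasure.toMeasure_injective
    rw [← hγ i, marginal, ProbabilityMeasure.toMeasure_map, ProbabilityMeasure.toMeasure_map,
      Measure.map_map (by fun_prop) hgr]
    rfl
  have hc := D.continuous_pairing (D.V *ᵥ a)
  have hi : Integrable (fun x => (D.V *ᵥ a + D.W *ᵥ D.vec x + D.b) ⬝ᵥ (s x : Fin K₂ → ℝ))
      (γ : Measure D.XX) := by
    have h := hD.integrable hc (η : Measure (D.XX × D.S₂))
    rw [ProbabilityMeasure.toMeasure_map] at h
    exact h.comp_measurable hgr
  calc ∫ x, D.Q a x ∂(γ : Measure D.XX)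
      ≤ ∫ x, ((D.V *ᵥ a + D.W *ᵥ D.vec x + D.b) ⬝ᵥ (s x : Fin K₂ → ℝ) + δ)
          ∂(γ : Measure D.XX) :=
        integral_mono (hD.integrable_Q a _) (hi.add (integrable_const δ)) fun x =>
          ciSup_le fun l => hsle x l
    _ = (D.V *ᵥ a) ⬝ᵥ D.meanDual η + D.costIntegral η + δ := by
        rw [integral_add hi (integrable_const δ), ← hD.integral_pairing,
          ProbabilityMeasure.toMeasure_map, integral_map hgr.aemeasurable hc.aestronglyMeasurable]
        simp
    _ ≤ R + δ := by
        gcongr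
        exact hR η hη

/-- Strong duality, for the relaxation to moment sets. -/
theorem Standing.phiDRO_le_dualValue (hD : D.Standing) {G : ∀ i, Set (D.X i → ℝ)}
    (hG : ∀ i, D.μ i ∈ momentSet (D.μ i) (G i)) : D.phiDRO ≤ D.dualValue G := by
  -- Comparing with real `r` above the dual value covers infinite dual values as well.
  refine EReal.le_of_forall_lt_iff_le.1 fun r hr => ?_
  obtain ⟨a, ha, hle⟩ := exists_primal_le_of_dual_lt D.c₁ D.Lin D.qin D.Leq D.qeq D.V
    (hD.isCompact_Γaug.image hD.continuous_moments) hD.convex_moments hD.S₁_nonempty (r := r) (by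
      rintro ξin ξeq _ ⟨η, hη, rfl⟩ hξ hc
      refine EReal.coe_lt_coe_iff.1 (lt_of_le_of_lt ?_ hr)
      exact le_iSup_of_le ξin (le_iSup_of_le ξeq (le_iSup_of_le η
        (le_iSup_of_le (f := fun _ => ((D.dualObjective ξin ξeq η : ℝ) : EReal))
          ⟨hξ, ⟨D.μ, hG, hη⟩, hc⟩ le_rfl))))
  refine (iInf₂_le a ha).trans ?_
  have hQ : ⨆ γ ∈ D.Γ D.μ, ((∫ x, D.Q a x ∂(γ : Measure D.XX) : ℝ) : EReal) ≤
      ((r - D.c₁ ⬝ᵥ a : ℝ) : EReal) := by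
    refine iSup₂_le fun γ hγ => EReal.coe_le_coe_iff.2 ?_
    refine hD.integral_Q_le (fun η hη => ?_) hγ
    have := hle _ ⟨η, hη, rfl⟩
    simp only at this
    linarith
  calc D.phi a ≤ ((D.c₁ ⬝ᵥ a : ℝ) : EReal) + ((r - D.c₁ ⬝ᵥ a : ℝ) : EReal) := by
        unfold phi
        gcongr
    _ = (r : EReal) := by
        rw [← EReal.coe_add, add_sub_cancel]

/-! ### Cost of reassembly -/

/-- With `l` shared, `b` cancels and `⟨x - x', Wᵀ l⟩` remains; this is the `ℓ¹`–`ℓ^∞` Hölder bound.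
-/
theorem enorm_cost_sub_le (x x' : D.XX) (l : D.S₂) :
    ‖(D.W *ᵥ D.vec x + D.b) ⬝ᵥ (l : Fin K₂ → ℝ) - (D.W *ᵥ D.vec x' + D.b) ⬝ᵥ (l : Fin K₂ → ℝ)‖ₑ ≤
      (∑ i, ENNReal.ofReal |(x i : ℝ) - (x' i : ℝ)|) * ⨆ l ∈ D.S₂, ‖D.Wᵀ *ᵥ l‖ₑ := by
  have h : (D.W *ᵥ D.vec x + D.b) ⬝ᵥ (l : Fin K₂ → ℝ) -
      (D.W *ᵥ D.vec x' + D.b) ⬝ᵥ (l : Fin K₂ → ℝ) =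
      ∑ i, ((x i : ℝ) - (x' i : ℝ)) * (D.Wᵀ *ᵥ (l : Fin K₂ → ℝ)) i := by
    rw [← sub_dotProduct, add_sub_add_right_eq_sub, ← mulVec_sub, dotProduct_comm,
      dotProduct_mulVec, ← mulVec_transpose, dotProduct_comm]
    rfl
  rw [h, Finset.sum_mul]
  refine (enorm_sum_le _ _).trans (Finset.sum_le_sum fun i _ => ?_)
  rw [enorm_mul, Real.enorm_eq_ofReal_abs]
  gcongr
  refine le_trans ?_ (le_iSup₂_of_le (l : Fin K₂ → ℝ) l.2 le_rfl)
  exact ENNReal.coe_le_coe.2 (nnnorm_le_pi_nnnorm _ i)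

/-- Passing to a partial reassembly changes the expected cost by at most a multiple of the sum of
the Wasserstein distances between the marginals. -/
theorem Standing.ofReal_costIntegral_sub_le (hD : D.Standing)
    {η η' : ProbabilityMeasure (D.XX × D.S₂)} (h : η' ∈ D.partialReassemblies η) :
    ENNReal.ofReal (D.costIntegral η - D.costIntegral η') ≤
      (∑ i, W1 (D.marginal η i) (D.μ i)) * ⨆ l ∈ D.S₂, ‖D.Wᵀ *ᵥ l‖ₑ := by
  obtain ⟨-, γ, hη, hγ, hη'⟩ := h
  have m₁ : Measurable fun t : D.XX × D.XX × D.S₂ => (t.1, t.2.2) := by fun_prop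
  have m₂ : Measurable fun t : D.XX × D.XX × D.S₂ => (t.2.1, t.2.2) := by fun_prop
  have hi : Integrable (fun t : D.XX × D.XX × D.S₂ =>
      (D.W *ᵥ D.vec t.1 + D.b) ⬝ᵥ (t.2.2 : Fin K₂ → ℝ)) (γ : Measure (D.XX × D.XX × D.S₂)) := by
    have := hD.integrable D.continuous_cost (η : Measure (D.XX × D.S₂))
    rw [← hη] at this
    exact this.comp_measurable m₁
  have hi' : Integrable (fun t : D.XX × D.XX × D.S₂ =>
      (D.W *ᵥ D.vec t.2.1 + D.b) ⬝ᵥ (t.2.2 : Fin K₂ → ℝ)) (γ : Measure (D.XX × D.XX × D.S₂)) := by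
    have := hD.integrable D.continuous_cost (η' : Measure (D.XX × D.S₂))
    rw [← hη'] at this
    exact this.comp_measurable m₂
  have htr : ∀ i, ∫⁻ t, ENNReal.ofReal |(t.1 i : ℝ) - (t.2.1 i : ℝ)|
      ∂(γ : Measure (D.XX × D.XX × D.S₂)) = W1 (D.marginal η i) (D.μ i) := by
    intro i
    obtain ⟨γi, -, hγi, hcost⟩ := hγ i
    rw [← hcost, ← hγi, transportCost, lintegral_map (by fun_prop) (by fun_prop)]
  have hdiff : D.costIntegral η - D.costIntegral η' =
      ∫ t, ((D.W *ᵥ D.vec t.1 + D.b) ⬝ᵥ (t.2.2 : Fin K₂ → ℝ) -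
        (D.W *ᵥ D.vec t.2.1 + D.b) ⬝ᵥ (t.2.2 : Fin K₂ → ℝ))
        ∂(γ : Measure (D.XX × D.XX × D.S₂)) := by
    rw [integral_sub hi hi', costIntegral, costIntegral, ← hη, ← hη',
      integral_map m₁.aemeasurable D.continuous_cost.aestronglyMeasurable,
      integral_map m₂.aemeasurable D.continuous_cost.aestronglyMeasurable]
  calc ENNReal.ofReal (D.costIntegral η - D.costIntegral η')
      ≤ ‖D.costIntegral η - D.costIntegral η'‖ₑ := Real.ofReal_le_enorm _
    _ ≤ ∫⁻ t, ‖(D.W *ᵥ D.vec t.1 + D.b) ⬝ᵥ (t.2.2 : Fin K₂ → ℝ) -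
          (D.W *ᵥ D.vec t.2.1 + D.b) ⬝ᵥ (t.2.2 : Fin K₂ → ℝ)‖ₑ
          ∂(γ : Measure (D.XX × D.XX × D.S₂)) := by
        rw [hdiff]
        exact enorm_integral_le_lintegral_enorm _
    _ ≤ ∫⁻ t, (∑ i, ENNReal.ofReal |(t.1 i : ℝ) - (t.2.1 i : ℝ)|) * ⨆ l ∈ D.S₂, ‖D.Wᵀ *ᵥ l‖ₑ
          ∂(γ : Measure (D.XX × D.XX × D.S₂)) :=
        lintegral_mono fun t => enorm_cost_sub_le t.1 t.2.1 t.2.2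
    _ = (∑ i, W1 (D.marginal η i) (D.μ i)) * ⨆ l ∈ D.S₂, ‖D.Wᵀ *ᵥ l‖ₑ := by
        rw [lintegral_mul_const _ (by fun_prop), lintegral_finsetSum _ (by fun_prop)]
        simp only [htr]

/-- Both measures share the `S₂`-marginal of the gluing measure, so dual feasibility survives
reassembly. -/
theorem meanDual_eq_of_mem_partialReassemblies {η η' : ProbabilityMeasure (D.XX × D.S₂)}
    (h : η' ∈ D.partialReassemblies η) : D.meanDual η' = D.meanDual η := by
  obtain ⟨-, γ, hη, -, hη'⟩ := h
  funext k
  rw [meanDual, meanDual, ← hη, ← hη',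
    integral_map (by fun_prop) (D.continuous_dual_coord k).aestronglyMeasurable,
    integral_map (by fun_prop) (D.continuous_dual_coord k).aestronglyMeasurable]

end DROData

/-! ### The two-sided bound -/

theorem theorem3 {N K₁ K₂ nin neq : ℕ} (D : DROData N K₁ K₂ nin neq) (hD : D.Standing)
    (m : Fin N → ℕ) (g : ∀ i, Fin (m i) → D.X i → ℝ) (hg : ∀ i j, Continuous (g i j))
    (ε : ℝ) (hε : 0 ≤ ε)
    (ξin : Fin nin → ℝ) (ξeq : Fin neq → ℝ) (μhat : ProbabilityMeasure (D.XX × D.S₂))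
    (hopt : D.IsEpsOptimizer (fun i => Set.range (g i)) ε ξin ξeq μhat)
    (μtil : ProbabilityMeasure (D.XX × D.S₂)) (htil : μtil ∈ D.partialReassemblies μhat) :
    D.phiDRO - D.errorBound (fun i => Set.range (g i)) ε ≤
        ((D.dualObjective ξin ξeq μtil : ℝ) : EReal) ∧
      ((D.dualObjective ξin ξeq μtil : ℝ) : EReal) ≤ D.phiDRO := by
  obtain ⟨⟨hξ, ⟨ν, hν, hνη⟩, hc⟩, hge⟩ := hopt
  constructor
  · have hG : ∀ i, D.μ i ∈ momentSet (D.μ i) (Set.range (g i)) := by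
      refine fun i => ⟨?_, fun _ _ => rfl⟩
      rintro _ ⟨j, rfl⟩
      have := isCompact_iff_compactSpace.1 (hD.X_compact i)
      exact (hg i j).integrable_of_hasCompactSupport (HasCompactSupport.of_compactSpace _)
    set E : ℝ≥0∞ := (∑ i, W1bar (D.μ i) (Set.range (g i))) * ⨆ l ∈ D.S₂, ‖D.Wᵀ *ᵥ l‖ₑ with hE
    have herr : D.errorBound (fun i => Set.range (g i)) ε = (ε : EReal) + (E : EReal) := rfl
    have hW : ENNReal.ofReal (D.costIntegral μhat - D.costIntegral μtil) ≤ E := by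
      refine (hD.ofReal_costIntegral_sub_le htil).trans ?_
      rw [hE]
      gcongr with i
      -- The reassembly transports `marginal μhat i` to `D.μ i`, whereas `W1bar` measures from `D.μ
      -- i`.
      rw [W1_comm, hνη i]
      exact le_iSup₂_of_le (ν i) (hν i) le_rfl
    have hobj : ((D.dualObjective ξin ξeq μhat : ℝ) : EReal) ≤
        ((D.dualObjective ξin ξeq μtil : ℝ) : EReal) + (E : EReal) := by
      have h1 : ((D.costIntegral μhat - D.costIntegral μtil : ℝ) : EReal) ≤ (E : EReal) := by
        refine le_trans ?_ (EReal.coe_ennreal_le_coe_ennreal_iff.2 hW)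
        rw [EReal.coe_ennreal_ofReal]
        exact EReal.coe_le_coe_iff.2 (le_max_left _ _)
      calc ((D.dualObjective ξin ξeq μhat : ℝ) : EReal)
          = ((D.dualObjective ξin ξeq μtil : ℝ) : EReal) +
              ((D.costIntegral μhat - D.costIntegral μtil : ℝ) : EReal) := by
            rw [← EReal.coe_add]
            congr 1
            unfold DROData.dualObjective
            ring
        _ ≤ _ := by gcongr
    have hphi : D.phiDRO ≤ ((D.dualObjective ξin ξeq μhat : ℝ) : EReal) + (ε : EReal) :=
      (hD.phiDRO_le_dualValue hG).trans
        (EReal.sub_le_iff_le_add (.inl (EReal.coe_ne_bot ε)) (.inl (EReal.coe_ne_top ε)) |>.1 hge)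
    rw [herr]
    refine EReal.sub_le_of_le_add (hphi.trans ?_)
    calc ((D.dualObjective ξin ξeq μhat : ℝ) : EReal) + (ε : EReal)
        ≤ ((D.dualObjective ξin ξeq μtil : ℝ) : EReal) + (E : EReal) + (ε : EReal) := by gcongr
      _ = _ := by rw [add_assoc, add_comm (E : EReal)]
  · refine le_iInf₂ fun a ha => hD.dualObjective_le_phi hξ htil.1 ?_ ha
    rw [DROData.meanDual_eq_of_mem_partialReassemblies htil, hc]
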